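/- **Theorem (Discrete gradient existence theorem).** Let $n\in\mathbb N$ and let $\|\cdot\|$ be the Euclidean norm on $\mathbb R^n$. A *discrete gradient* of a continuously differentiable function $V:\mathbb R^n\to\mathbb R$ is a continuous map $\overline\nabla V:\mathbb R^n\times\mathbb R^n\to\mathbb R^n$ such that for all $x,y\in\mathbb R^n$ $$\langle \overline\nabla V(x,y),\,y-x\rangle = V(y)-V(x),\qquad \lim_{y\to x}\overline\nabla V(x,y)=\nabla V(x).$$ Let $\overline\nabla$ be a construction that assigns to every $V\in C^1(\mathbb R^n;\mathbb R)$ a discrete gradient $\overline\nabla V$ of $V$. Write $K_r=\{z\in\mathbb R^n:\operatorname{dist}(K,z)\le r\}$ for $r\in[0,\infty]$. Assume that there are a constant $C_n$ (independent of $V$) and a continuous, nondecreasing function $\delta:[0,\infty]\to[0,\infty]$ with $\delta(0)=0$ and $\delta(\infty)=\lim_{r\to\infty}\delta(r)$ such that, for every $V\in C^1(\mathbb R^n;\mathbb R)$ and every convex set $K\subset\mathbb R^n$ with nonempty interior: 1. if $L$ is such that $\|\nabla V(z)\|\le L$ for all $z\in K_{\delta(\operatorname{diam}K)}$, then $\|\overline\nabla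 V(x,y)\|\le C_nL$ for all $x,y\in K$; 2. if $W\in C^1(\mathbb R^n;\mathbb R)$ satisfies $W(z)=V(z)$ for all $z\in K_{\delta(\operatorname{diam}K)}$, then $\overline\nabla V(x,y)=\overline\nabla W(x,y)$ for all $x,y\in K$. Let $V:\mathbb R^n\to\mathbb R$ be continuously differentiable, $\tau>0$ and $x\in\mathbb R^n$. Then there exists $y\in\mathbb R^n$ with $$y=x-\tau\,\overline\nabla V(x,y),$$ provided that at least one of the following holds: - (i) $\nabla V$ is uniformly bounded on $\mathbb R^n$; - (ii) $V$ is coercive, i.e. $\{z\in\mathbb R^n: V(z)\le M\}$ is bounded for every $M\in\mathbb R$; - (iii) both $V$ and $\nabla V$ are bounded on the convex hull of $\{z\in\mathbb R^n: V(z)\le V(x)\}$ (the bounds may depend on $x$), and $\delta\equiv 0$ in the assumption above. -/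

import Mathlib

open Filter Topology

/-- `G` is a discrete gradient of `V`: a continuous map `ℝⁿ × ℝⁿ → ℝⁿ` with the mean value
property and the consistency property. -/
structure IsDiscreteGradient {n : ℕ} (V : EuclideanSpace ℝ (Fin n) → ℝ)
    (G : EuclideanSpace ℝ (Fin n) → EuclideanSpace ℝ (Fin n) → EuclideanSpace ℝ (Fin n)) :
    Prop where
  continuous : Continuous (fun p : EuclideanSpace ℝ (Fin n) × EuclideanSpace ℝ (Fin n) =>
    G p.1 p.2)
  mean_value : ∀ x y, inner ℝ (G x y) (y - x) = V y - V x
  consistency : ∀ x, Tendsto (fun y => G x y) (𝓝[≠] x) (𝓝 (gradient V x))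

/-- A discrete gradient construction assigns a discrete gradient `dg V` to each continuously
differentiable `V` (the values at other functions are irrelevant). -/
def IsDiscreteGradientConstruction {n : ℕ}
    (dg : (EuclideanSpace ℝ (Fin n) → ℝ) →
      EuclideanSpace ℝ (Fin n) → EuclideanSpace ℝ (Fin n) → EuclideanSpace ℝ (Fin n)) : Prop :=
  ∀ V : EuclideanSpace ℝ (Fin n) → ℝ, ContDiff ℝ 1 V → IsDiscreteGradient V (dg V)

/-- The closed thickening `K_r = {z | dist (K, z) ≤ r}`, with `r ∈ [0, ∞]`. -/
def closedThickening {n : ℕ} (r : ENNReal) (K : Set (EuclideanSpace ℝ (Fin n))) :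
    Set (EuclideanSpace ℝ (Fin n)) :=
  {z | Metric.infEDist z K ≤ r}

/-- The standing assumption on a discrete gradient construction, with constant `C` and modulus
`δ : [0, ∞] → [0, ∞]`. Continuity of `δ` on `[0, ∞]` includes that
`δ ∞` is the limit of `δ r` as `r → ∞`. -/
structure BoundedAndLocal {n : ℕ}
    (dg : (EuclideanSpace ℝ (Fin n) → ℝ) →
      EuclideanSpace ℝ (Fin n) → EuclideanSpace ℝ (Fin n) → EuclideanSpace ℝ (Fin n))
    (C : ℝ) (δ : ENNReal → ENNReal) : Prop where
  continuous_modulus : Continuous δ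
  monotone_modulus : Monotone δ
  modulus_zero : δ 0 = 0
  /-- A bound on the gradient gives a bound on the discrete gradient. -/
  bounded : ∀ V : EuclideanSpace ℝ (Fin n) → ℝ, ContDiff ℝ 1 V →
    ∀ K : Set (EuclideanSpace ℝ (Fin n)), Convex ℝ K → (interior K).Nonempty →
    ∀ L : ℝ, (∀ z ∈ closedThickening (δ (Metric.ediam K)) K, ‖gradient V z‖ ≤ L) →
    ∀ x ∈ K, ∀ y ∈ K, ‖dg V x y‖ ≤ C * L
  /-- The discrete gradient depends on the function only locally. -/
  locality : ∀ V W : EuclideanSpace ℝ (Fin n) → ℝ, ContDiff ℝ 1 V → ContDiff ℝ 1 W →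
    ∀ K : Set (EuclideanSpace ℝ (Fin n)), Convex ℝ K → (interior K).Nonempty →
    (∀ z ∈ closedThickening (δ (Metric.ediam K)) K, V z = W z) →
    ∀ x ∈ K, ∀ y ∈ K, dg V x y = dg W x y

/-- `V` is coercive: all its sublevel sets are bounded. -/
def IsCoerciveFunction {n : ℕ} (V : EuclideanSpace ℝ (Fin n) → ℝ) : Prop :=
  ∀ M : ℝ, Bornology.IsBounded {z | V z ≤ M}

/-! Put `y = x + u` and apply the Leray–Schauder alternative to `u ↦ -τ ∇̄V(x, x + u)`. A solution
of the homotopy equation is a discrete gradient step of size `σ ≤ τ`, so the mean value property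
makes `V` decrease. Hence only the sublevel set of `V x` matters, and each of (i)–(iii) bounds
either `y` or `∇̄V(x, y)` there.

The alternative rests on a Brouwer-type fact: `x + h x` has a zero when `h` is continuous with
compact support. Otherwise smooth `h` and push `x + h x` radially onto a sphere, giving a Lipschitz
map `r` equal to the identity outside a ball. By `setIntegral_det_one_add_fderiv` the integral of
`det Dr` over the ball is the ball's volume, yet `det Dr = 0` there because `‖r‖` is constant. -/

/-- Extrapolation to `1` of polynomials of bounded degree from nodes in `(0, ε)`. -/
theorem exists_extrapolation_weights (d : ℕ) {ε : ℝ} (hε : 0 < ε) :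
    ∃ w t : Fin (d + 1) → ℝ, (∀ i, 0 < t i ∧ t i < ε) ∧
      ∀ p : Polynomial ℝ, p.natDegree ≤ d → p.eval 1 = ∑ i, w i * p.eval (t i) := by
  let t : Fin (d + 1) → ℝ := fun i => ε * ((i : ℝ) + 1) / (d + 2)
  have ht : Function.Injective t := by
    intro i j hij
    have hd : (d : ℝ) + 2 ≠ 0 := by positivity
    simp only [t] at hij
    field_simp at hij
    exact Fin.ext (by exact_mod_cast (add_right_cancel hij))
  refine ⟨fun i => (Lagrange.basis Finset.univ t i).eval 1, t, fun i => ⟨by positivity, ?_⟩, ?_⟩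
  · have hi : ((i : ℕ) : ℝ) + 1 < d + 2 := by
      have := i.2
      exact_mod_cast (by omega : (i : ℕ) + 1 < d + 2)
    rw [div_lt_iff₀ (by positivity)]
    gcongr
  · intro p hp
    have hdeg : p.degree < (Finset.univ : Finset (Fin (d + 1))).card := by
      refine lt_of_le_of_lt (Polynomial.degree_le_of_natDegree_le hp) ?_
      rw [Finset.card_univ, Fintype.card_fin]
      exact_mod_cast Nat.lt_succ_self d
    have h := Lagrange.eq_interpolate (s := Finset.univ) (v := t) ht.injOn hdeg
    conv_lhs => rw [h]
    simp [Lagrange.interpolate_apply, Polynomial.eval_finsetSum, mul_comm]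

/-! ### Determinants of perturbations of the identity -/

section Determinant

variable {E : Type*} [NormedAddCommGroup E] [NormedSpace ℝ E] [FiniteDimensional ℝ E]

theorem exists_polynomial_det_one_add_smul (A : E →L[ℝ] E) :
    ∃ p : Polynomial ℝ, p.natDegree ≤ Module.finrank ℝ E ∧
      ∀ t : ℝ, p.eval t = (1 + t • A).det := by
  let b := Module.finBasis ℝ E
  let M := LinearMap.toMatrix b b (A : E →ₗ[ℝ] E)
  refine ⟨Matrix.det ((Polynomial.X : Polynomial ℝ) • M.map Polynomial.C +
    (1 : Matrix _ _ ℝ).map Polynomial.C), ?_, fun t => ?_⟩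
  · simpa using Polynomial.natDegree_det_X_add_C_le M 1
  · rw [ContinuousLinearMap.det, ← LinearMap.det_toMatrix b, ← Polynomial.coe_evalRingHom,
      RingHom.map_det]
    congr 1
    ext i j
    rcases eq_or_ne i j with rfl | hij
    · simp [M, LinearMap.toMatrix_apply]
      ring
    · simp [M, LinearMap.toMatrix_apply, hij]
      ring

/-- No `1 + s • A` with `s ∈ [0, 1]` has a kernel, so the determinant keeps the sign it has at `s =
0`. -/
theorem det_one_add_pos {A : E →L[ℝ] E} (hA : ‖A‖ < 1) : 0 < (1 + A).det := by
  have hne : ∀ s ∈ Set.Icc (0 : ℝ) 1, (1 + s • A).det ≠ 0 := by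
    intro s hs h0
    obtain ⟨v, hv, hv0⟩ :=
      (Submodule.ne_bot_iff _).1 (LinearMap.bot_lt_ker_of_det_eq_zero h0).ne'
    have hv' : v = -(s • A v) := by
      have : v + s • A v = 0 := by simpa using hv
      exact eq_neg_of_add_eq_zero_left this
    have h1 : ‖v‖ ≤ ‖A‖ * ‖v‖ := by
      calc ‖v‖ = ‖s • A v‖ := by conv_lhs => rw [hv', norm_neg]
        _ = s * ‖A v‖ := by rw [norm_smul, Real.norm_of_nonneg hs.1]
        _ ≤ 1 * ‖A v‖ := by gcongr; exact hs.2
        _ ≤ ‖A‖ * ‖v‖ := by rw [one_mul]; exact A.le_opNorm v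
    have : 0 < ‖v‖ := norm_pos_iff.2 hv0
    nlinarith
  have hcont : Continuous fun s : ℝ => (1 + s • A).det :=
    ContinuousLinearMap.continuous_det.comp (by fun_prop)
  by_contra hneg
  push Not at hneg
  have h := intermediate_value_Icc' (zero_le_one' ℝ) hcont.continuousOn
  obtain ⟨s, hs, hs0⟩ := h (show (0 : ℝ) ∈ _ by simpa [ContinuousLinearMap.det] using hneg)
  exact hne s hs hs0

end Determinant

/-! ### Contractive perturbations of the identity -/

section Perturbation

variable {E : Type*} [NormedAddCommGroup E]

/-- A contractive perturbation of the identity supported in a ball permutes that ball. -/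
theorem bijOn_ball_add_of_lipschitz [CompleteSpace E] {h : E → E} {k : NNReal} (hk : k < 1)
    (hh : LipschitzWith k h) {R : ℝ} (h0 : ∀ x, R ≤ ‖x‖ → h x = 0) :
    Set.BijOn (fun x => x + h x) (Metric.ball 0 R) (Metric.ball 0 R) := by
  have hinj : Function.Injective fun x => x + h x := by
    intro x y hxy
    have h1 : x - y = h y - h x := by
      have : x + h x = y + h y := hxy
      rw [sub_eq_sub_iff_add_eq_add, this, add_comm]
    have h2 : ‖x - y‖ ≤ k * ‖x - y‖ := by
      conv_lhs => rw [h1, norm_sub_rev]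
      simpa [dist_eq_norm] using hh.dist_le_mul x y
    have hk' : (k : ℝ) < 1 := by exact_mod_cast hk
    have : ‖x - y‖ = 0 := by nlinarith [norm_nonneg (x - y)]
    exact sub_eq_zero.1 (norm_eq_zero.1 this)
  refine ⟨fun x hx => ?_, hinj.injOn, fun y hy => ?_⟩
  -- An image outside the ball is itself a fixed point, so by injectivity it equals `x`, which lies
  -- inside.
  · by_contra hn
    have hn' : R ≤ ‖x + h x‖ := by simpa using hn
    have : (fun x => x + h x) (x + h x) = x + h x := by simp [h0 _ hn']
    have := hinj this
    rw [this] at hn'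
    exact absurd hn' (by simpa using hx)
  · have hc : ContractingWith k fun x => y - h x :=
      ⟨hk, LipschitzWith.of_dist_le_mul fun a b => by
        simpa [dist_eq_norm, norm_sub_rev] using hh.dist_le_mul a b⟩
    have : Nonempty E := ⟨y⟩
    have hz := hc.fixedPoint_isFixedPt
    set z := hc.fixedPoint
    have hz' : y - h z = z := hz
    have hzy : z + h z = y := (sub_eq_iff_eq_add.1 hz').symm
    refine ⟨z, ?_, hzy⟩
    by_contra hn
    have hn' : R ≤ ‖z‖ := by simpa using hn
    rw [h0 _ hn', add_zero] at hzy
    exact hn (hzy ▸ hy)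

end Perturbation

/-! ### Integral of the Jacobian determinant -/

section VolumeArgument

open MeasureTheory

variable {E : Type*} [NormedAddCommGroup E] [NormedSpace ℝ E] [FiniteDimensional ℝ E]
  [MeasurableSpace E] [BorelSpace E]

/-- Change of variables: for small `t` the map `x + t • h x` permutes the ball and its Jacobian is
positive. -/
theorem setIntegral_det_one_add_smul_fderiv (μ : Measure E) [μ.IsAddHaarMeasure] {h : E → E}
    {K : NNReal} (hh : LipschitzWith K h) {R : ℝ} (h0 : ∀ x, R ≤ ‖x‖ → h x = 0)
    (hd : ∀ x ∈ Metric.ball (0 : E) R, DifferentiableAt ℝ h x) {t : ℝ} (ht : 0 ≤ t)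
    (htK : t * K < 1) :
    ∫ x in Metric.ball 0 R, (1 + t • fderiv ℝ h x).det ∂μ = μ.real (Metric.ball 0 R) := by
  lift t to NNReal using ht
  have hlip : LipschitzWith (t * K) fun x => t • h x := by
    have := (lipschitzWith_smul t (α := ℝ) (β := E)).comp hh
    simpa using! this
  have hbij := bijOn_ball_add_of_lipschitz (by exact_mod_cast htK) hlip
    (R := R) fun x hx => by rw [h0 x hx, smul_zero]
  have hder : ∀ x ∈ Metric.ball (0 : E) R, HasFDerivWithinAt (fun x => x + t • h x)
      (1 + (t : ℝ) • fderiv ℝ h x) (Metric.ball 0 R) x := fun x hx =>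
    ((hasFDerivAt_id x).add ((hd x hx).hasFDerivAt.const_smul (t : ℝ))).hasFDerivWithinAt
  have hint := integral_image_eq_integral_abs_det_fderiv_smul μ measurableSet_ball hder
    hbij.injOn fun _ => (1 : ℝ)
  rw [hbij.image_eq] at hint
  simp only [integral_const, smul_eq_mul, mul_one, measureReal_restrict_apply_univ] at hint
  rw [hint]
  refine setIntegral_congr_fun measurableSet_ball fun x _ => (abs_of_pos ?_).symm
  refine det_one_add_pos (lt_of_le_of_lt ?_ htK)
  rw [norm_smul]
  gcongr
  · simp
  · exact norm_fderiv_le_of_lipschitz ℝ hh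

theorem integrableOn_det_one_add_smul_fderiv (μ : Measure E) [IsFiniteMeasureOnCompacts μ]
    {h : E → E} {K : NNReal} (hh : LipschitzWith K h) (R t : ℝ) :
    IntegrableOn (fun x => (1 + t • fderiv ℝ h x).det) (Metric.ball 0 R) μ := by
  have hcont : Continuous fun A : E →L[ℝ] E => (1 + t • A).det :=
    ContinuousLinearMap.continuous_det.comp (by fun_prop)
  obtain ⟨M, hM⟩ := (isCompact_closedBall (0 : E →L[ℝ] E) K).exists_bound_of_continuousOn
    hcont.continuousOn
  refine Measure.integrableOn_of_bounded (M := M) measure_ball_lt_top.ne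
    (hcont.measurable.comp (measurable_fderiv ℝ h)).aestronglyMeasurable
    (Eventually.of_forall fun x => hM _ ?_)
  simpa using norm_fderiv_le_of_lipschitz ℝ hh

/-- The integrand is pointwise a polynomial in `t` of degree at most the dimension, so its value at
`t = 1` is a fixed combination, with weights of sum `1`, of values at small `t`. -/
theorem setIntegral_det_one_add_fderiv (μ : Measure E) [μ.IsAddHaarMeasure] {h : E → E}
    {K : NNReal} (hh : LipschitzWith K h) {R : ℝ} (h0 : ∀ x, R ≤ ‖x‖ → h x = 0)
    (hd : ∀ x ∈ Metric.ball (0 : E) R, DifferentiableAt ℝ h x) :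
    ∫ x in Metric.ball 0 R, (1 + fderiv ℝ h x).det ∂μ = μ.real (Metric.ball 0 R) := by
  obtain ⟨w, t, ht, hw⟩ := exists_extrapolation_weights (Module.finrank ℝ E)
    (ε := 1 / (K + 1)) (by positivity)
  have hpt : ∀ x, (1 + fderiv ℝ h x).det = ∑ i, w i * (1 + t i • fderiv ℝ h x).det := by
    intro x
    obtain ⟨p, hp, hpe⟩ := exists_polynomial_det_one_add_smul (fderiv ℝ h x)
    have := hw p hp
    simpa only [hpe, one_smul] using this
  simp_rw [hpt]
  rw [integral_finsetSum _ fun i _ =>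
    (integrableOn_det_one_add_smul_fderiv μ hh R (t i)).const_mul (w i)]
  have hw1 : ∑ i, w i = 1 := by simpa using (hw 1 (by simp)).symm
  rw [← one_mul (μ.real _), ← hw1, Finset.sum_mul]
  refine Finset.sum_congr rfl fun i _ => ?_
  rw [integral_const_mul, setIntegral_det_one_add_smul_fderiv μ hh h0 hd (ht i).1.le]
  have h1 := (ht i).2
  rw [lt_div_iff₀ (by positivity)] at h1
  nlinarith [(ht i).1]

end VolumeArgument

/-! ### Radial projection -/

section Radial

variable {E : Type*} [NormedAddCommGroup E] [NormedSpace ℝ E]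

/-- The map fixing every vector of norm at least `R` and moving every vector `v` with
`ε ≤ ‖v‖ ≤ R` to norm `R` along its ray is Lipschitz. -/
theorem exists_lipschitzWith_radial {ε R : ℝ} (hε : 0 < ε) (hεR : ε ≤ R) :
    ∃ K, LipschitzWith K fun v : E => max 1 (R / max ‖v‖ ε) • v := by
  have hR : 0 < R := hε.trans_le hεR
  have key : ∀ v w : E, ‖v‖ ≤ ‖w‖ →
      ‖max 1 (R / max ‖v‖ ε) • v - max 1 (R / max ‖w‖ ε) • w‖ ≤
        (R / ε + R * (R / ε ^ 2)) * ‖v - w‖ := by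
    intro v w hvw
    set a := max 1 (R / max ‖v‖ ε) with ha
    set b := max 1 (R / max ‖w‖ ε) with hb
    have hb0 : 0 ≤ b := zero_le_one.trans (le_max_left _ _)
    have hbε : b ≤ R / ε := max_le ((one_le_div hε).2 hεR)
      (div_le_div_of_nonneg_left hR.le hε (le_max_right _ _))
    have hmv : 0 < max ‖v‖ ε := hε.trans_le (le_max_right _ _)
    have hmw : 0 < max ‖w‖ ε := hε.trans_le (le_max_right _ _)
    have hab : |a - b| ≤ R / ε ^ 2 * ‖v - w‖ := by
      calc |a - b| ≤ |R / max ‖v‖ ε - R / max ‖w‖ ε| := by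
            simpa [ha, hb, max_comm] using
              abs_max_sub_max_le_abs (R / max ‖v‖ ε) (R / max ‖w‖ ε) 1
        _ = R / (max ‖v‖ ε * max ‖w‖ ε) * |max ‖w‖ ε - max ‖v‖ ε| := by
            rw [div_sub_div _ _ hmv.ne' hmw.ne', show R * max ‖w‖ ε - max ‖v‖ ε * R = R * (max ‖w‖ ε - max ‖v‖ ε) by ring,
              abs_div, abs_mul,
              abs_of_pos hR, abs_of_pos (mul_pos hmv hmw)]
            ring
        _ ≤ R / (ε * ε) * ‖v - w‖ := by
            gcongr
            · exact le_max_right _ _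
            · exact le_max_right _ _
            · refine (abs_max_sub_max_le_abs _ _ _).trans ?_
              rw [norm_sub_rev]
              exact abs_norm_sub_norm_le w v
        _ = R / ε ^ 2 * ‖v - w‖ := by rw [sq]
    -- When `‖v‖ > R` both factors are `1`, so only `‖v‖ ≤ R` contributes.
    have habv : |a - b| * ‖v‖ ≤ R / ε ^ 2 * ‖v - w‖ * R := by
      rcases le_total ‖v‖ R with hv | hv
      · gcongr
      · have ha1 : a = 1 := max_eq_left ((div_le_one hmv).2 (hv.trans (le_max_left _ _)))
        have hb1 : b = 1 := max_eq_left
          ((div_le_one hmw).2 ((hv.trans hvw).trans (le_max_left _ _)))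
        rw [ha1, hb1, sub_self, abs_zero, zero_mul]
        positivity
    calc ‖a • v - b • w‖ = ‖b • (v - w) + (a - b) • v‖ := by congr 1; module
      _ ≤ b * ‖v - w‖ + |a - b| * ‖v‖ := by
          refine (norm_add_le _ _).trans_eq ?_
          rw [norm_smul, norm_smul, Real.norm_of_nonneg hb0, Real.norm_eq_abs]
      _ ≤ R / ε * ‖v - w‖ + R / ε ^ 2 * ‖v - w‖ * R := by gcongr
      _ = _ := by ring
  refine ⟨⟨R / ε + R * (R / ε ^ 2), by positivity⟩, LipschitzWith.of_dist_le_mul fun v w => ?_⟩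
  rw [dist_eq_norm, dist_eq_norm]
  rcases le_total ‖v‖ ‖w‖ with h | h
  · exact key v w h
  · rw [norm_sub_rev, norm_sub_rev v w]
    exact key w v h

end Radial

/-! ### Zeros and fixed points -/

section FixedPoint

variable {E : Type*} [NormedAddCommGroup E] [InnerProductSpace ℝ E] [FiniteDimensional ℝ E]

/-- Differentiating `‖f‖ ^ 2` shows that the range of `f'` is orthogonal to `f x ≠ 0`. -/
theorem det_eq_zero_of_norm_eventually_const {f : E → E} {f' : E →L[ℝ] E} {x : E} {R : ℝ}
    (hf : HasFDerivAt f f' x) (hR : 0 < R) (hc : ∀ᶠ y in 𝓝 x, ‖f y‖ = R) : f'.det = 0 := by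
  by_contra hdet
  have h1 : HasFDerivAt (fun y => ‖f y‖ ^ 2) (0 : E →L[ℝ] ℝ) x :=
    (hasFDerivAt_const (R ^ 2) x).congr_of_eventuallyEq (hc.mono fun y hy => by simp [hy])
  have h2 := hf.norm_sq.unique h1
  obtain ⟨v, hv⟩ := (LinearMap.equivOfDetNeZero (f' : E →ₗ[ℝ] E) hdet).surjective (f x)
  have hv' : f' v = f x := hv
  have h3 := congrArg (fun A : E →L[ℝ] ℝ => A v) h2
  simp [hv', hc.self_of_nhds, hR.ne'] at h3

/-- A `C¹` compactly supported perturbation of the identity is not bounded away from zero. -/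
theorem not_bounded_below_of_contDiff {h : E → E} (hh : ContDiff ℝ 1 h) {R ε : ℝ} (hε : 0 < ε)
    (h0 : ∀ x, R ≤ ‖x‖ → h x = 0) : ¬ ∀ x, ε ≤ ‖x + h x‖ := by
  intro hlow
  borelize E
  have hsupp : HasCompactSupport h := HasCompactSupport.intro (isCompact_closedBall (0 : E) R)
    fun x hx => h0 x (by simpa using (not_le.1 (by simpa using hx)).le)
  obtain ⟨K, hK⟩ := hh.lipschitzWith_of_hasCompactSupport hsupp one_ne_zero
  obtain ⟨M, hM⟩ := hsupp.exists_bound_of_continuous hh.continuous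
  have hM0 : 0 ≤ M := (norm_nonneg _).trans (hM 0)
  -- Large enough that `h` vanishes beyond `S`, that `‖x + h x‖ ≤ S` on the ball, and that `ε ≤ S`.
  set S : ℝ := |R| + M + ε with hS
  have hSpos : 0 < S := by positivity
  have hRS : R ≤ S := (le_abs_self R).trans (by rw [hS]; linarith)
  have hεS : ε ≤ S := by rw [hS]; linarith [abs_nonneg R]
  obtain ⟨N, hN⟩ := exists_lipschitzWith_radial (E := E) hε hεS
  set r : E → E := fun x => max 1 (S / max ‖x + h x‖ ε) • (x + h x) with hr
  have hrLip : LipschitzWith (N * (1 + K)) r := hN.comp (LipschitzWith.id.add hK)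
  have hin : ∀ x ∈ Metric.ball (0 : E) S, r x = (S / ‖x + h x‖) • (x + h x) := by
    intro x hx
    have hle : ‖x + h x‖ ≤ S := by
      rcases le_total R ‖x‖ with hx' | hx'
      · rw [h0 x hx', add_zero]
        exact (by simpa using hx : ‖x‖ < S).le
      · refine (norm_add_le _ _).trans ?_
        linarith [hM x, le_abs_self R]
    simp only [hr]
    rw [max_eq_left (hlow x), max_eq_right ((one_le_div (hε.trans_le (hlow x))).2 hle)]
  have hnorm : ∀ x ∈ Metric.ball (0 : E) S, ‖r x‖ = S := by
    intro x hx
    have := (hε.trans_le (hlow x)).ne'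
    rw [hin x hx, norm_smul, norm_div, norm_norm, Real.norm_of_nonneg hSpos.le]
    field_simp
  have hrd : ∀ x ∈ Metric.ball (0 : E) S, DifferentiableAt ℝ r x := by
    intro x hx
    have hg : DifferentiableAt ℝ (fun x => x + h x) x :=
      differentiableAt_id.add (hh.differentiable one_ne_zero x)
    have hne : x + h x ≠ 0 := norm_pos_iff.1 (hε.trans_le (hlow x))
    have hd : DifferentiableAt ℝ (fun x => (S / ‖x + h x‖) • (x + h x)) x :=
      (((hg.norm ℝ hne).inv (norm_ne_zero_iff.2 hne)).const_mul S).smul hg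
    exact hd.congr_of_eventuallyEq
      (eventually_of_mem (Metric.isOpen_ball.mem_nhds hx) hin)
  have hout : ∀ x, S ≤ ‖x‖ → r x - x = 0 := by
    intro x hx
    have hx0 : 0 < ‖x‖ := hSpos.trans_le hx
    simp only [hr]
    rw [h0 x (hRS.trans hx), add_zero, max_eq_left (hεS.trans hx),
      max_eq_left ((div_le_one hx0).2 hx), one_smul, sub_self]
  have hvol := setIntegral_det_one_add_fderiv (MeasureTheory.Measure.addHaar (G := E))
    (hrLip.sub LipschitzWith.id) hout fun x hx => (hrd x hx).sub differentiableAt_id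
  have hzero : ∀ x ∈ Metric.ball (0 : E) S, (1 + fderiv ℝ (fun x => r x - x) x).det = 0 := by
    intro x hx
    have hfd : HasFDerivAt (fun x => r x - x) (fderiv ℝ r x - 1) x :=
      (hrd x hx).hasFDerivAt.sub (hasFDerivAt_id x)
    rw [hfd.fderiv, add_sub_cancel]
    exact det_eq_zero_of_norm_eventually_const (hrd x hx).hasFDerivAt hSpos
      (eventually_of_mem (Metric.isOpen_ball.mem_nhds hx) hnorm)
  have hint := MeasureTheory.setIntegral_congr_fun
    (μ := MeasureTheory.Measure.addHaar (G := E)) measurableSet_ball hzero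
  have hpos : 0 < (MeasureTheory.Measure.addHaar (G := E)).real (Metric.ball 0 S) :=
    ENNReal.toReal_pos (Metric.measure_ball_pos _ _ hSpos).ne'
      MeasureTheory.measure_ball_lt_top.ne
  have hvol' : ∫ x in Metric.ball 0 S, (1 + fderiv ℝ (fun x => r x - x) x).det
      ∂(MeasureTheory.Measure.addHaar (G := E)) =
        (MeasureTheory.Measure.addHaar (G := E)).real (Metric.ball 0 S) := hvol
  rw [hint, MeasureTheory.integral_zero] at hvol'
  exact hpos.ne hvol'

/-- A continuous compactly supported perturbation of the identity vanishes somewhere. -/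
theorem exists_add_eq_zero_of_eq_zero_outside_ball {h : E → E} (hh : Continuous h) {R : ℝ}
    (h0 : ∀ x, R ≤ ‖x‖ → h x = 0) : ∃ x, x + h x = 0 := by
  by_contra! hne
  obtain ⟨x₀, -, hmin⟩ := (isCompact_closedBall (0 : E) |R|).exists_isMinOn
    ⟨0, by simp⟩ (f := fun x => ‖x + h x‖) (by fun_prop)
  have hε : 0 < ‖x₀ + h x₀‖ := norm_pos_iff.2 (hne x₀)
  have hlow : ∀ x, ‖x₀ + h x₀‖ ≤ ‖x + h x‖ := by
    have hball : ∀ x : E, ‖x‖ ≤ |R| → ‖x₀ + h x₀‖ ≤ ‖x + h x‖ := fun x hx =>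
      hmin (by simpa using hx)
    intro x
    rcases le_total ‖x‖ |R| with hx | hx
    · exact hball x hx
    · obtain hx0 | hx0 := eq_or_ne ‖x‖ 0
      · exact hball x (by rw [hx0]; exact abs_nonneg R)
      · have hy : ‖(|R| / ‖x‖) • x‖ = |R| := by
          rw [norm_smul, norm_div, norm_norm, Real.norm_eq_abs, abs_abs]
          field_simp
        have := hball _ hy.le
        rw [h0 ((|R| / ‖x‖) • x) (by rw [hy]; exact le_abs_self R), add_zero, hy] at this
        rw [h0 x ((le_abs_self R).trans hx), add_zero]
        exact this.trans hx
  -- The support of `k` lies in that of `h`, so `k` also vanishes outside the ball.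
  obtain ⟨k, hk, hkd, hks⟩ := hh.exists_contDiff_approx 1 (ε := fun _ => ‖x₀ + h x₀‖ / 2)
    continuous_const fun _ => half_pos hε
  refine not_bounded_below_of_contDiff (h := k) (by exact_mod_cast hk) (half_pos hε) (R := R)
    (fun x hx => ?_) fun x => ?_
  · by_contra hkx
    exact hks hkx (h0 x hx)
  · have h1 := hlow x
    have h2 : ‖x + h x‖ ≤ ‖x + k x‖ + ‖k x - h x‖ := by
      have : x + h x = (x + k x) - (k x - h x) := by abel
      rw [this]
      exact norm_sub_le _ _
    have h3 := hkd x
    rw [dist_eq_norm] at h3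
    linarith

/-- The **Leray–Schauder alternative** (Schaefer's fixed point theorem) in finite dimension. -/
theorem exists_fixedPoint_of_bounded_homotopy {F : E → E} (hF : Continuous F) {R : ℝ}
    (hR : ∀ y, ∀ s ∈ Set.Icc (0 : ℝ) 1, y = s • F y → ‖y‖ ≤ R) : ∃ y, y = F y := by
  have hcut : ∀ y : E, max 0 (min 1 (R + 1 - ‖y‖)) ∈ Set.Icc (0 : ℝ) 1 := fun y =>
    ⟨le_max_left _ _, max_le zero_le_one (min_le_left _ _)⟩
  -- The cutoff is `1` for `‖y‖ ≤ R` and `0` for `‖y‖ ≥ R + 1`. It serves as the homotopy parameter,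
  -- so the a priori bound forces it to be `1` at the zero.
  obtain ⟨y, hy⟩ := exists_add_eq_zero_of_eq_zero_outside_ball
    (h := fun y => -(max 0 (min 1 (R + 1 - ‖y‖)) • F y)) (by fun_prop) (R := R + 1)
    fun y hy => by
      rw [max_eq_left ((min_le_right _ _).trans (by linarith)), zero_smul, neg_zero]
  rw [← sub_eq_add_neg, sub_eq_zero] at hy
  have hyR := hR y _ (hcut y) hy
  rw [min_eq_left (by linarith), max_eq_right zero_le_one, one_smul] at hy
  exact ⟨y, hy⟩

end FixedPoint

/-! ### A priori bounds for discrete gradient steps -/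

section DiscreteGradient

variable {n : ℕ} {V : EuclideanSpace ℝ (Fin n) → ℝ}
  {G : EuclideanSpace ℝ (Fin n) → EuclideanSpace ℝ (Fin n) → EuclideanSpace ℝ (Fin n)}

theorem IsDiscreteGradient.apply_self (hG : IsDiscreteGradient V G)
    (x : EuclideanSpace ℝ (Fin n)) : G x x = gradient V x := by
  rcases subsingleton_or_nontrivial (EuclideanSpace ℝ (Fin n)) with _ | _
  · exact Subsingleton.elim _ _
  · have : (𝓝[≠] x).NeBot := Module.punctured_nhds_neBot ℝ _ x
    have hc : Continuous fun y => G x y := hG.continuous.comp (Continuous.prodMk_right x)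
    exact tendsto_nhds_unique (hc.continuousWithinAt (s := {x}ᶜ) (x := x)) (hG.consistency x)

theorem IsDiscreteGradient.le_of_eq_sub_smul (hG : IsDiscreteGradient V G)
    {x y : EuclideanSpace ℝ (Fin n)} {τ : ℝ} (hτ : 0 ≤ τ) (hy : y = x - τ • G x y) :
    V y ≤ V x := by
  have hyx : y - x = -(τ • G x y) := by
    rw [sub_eq_iff_eq_add, neg_add_eq_sub]
    exact hy
  have hm := hG.mean_value x y
  rw [hyx, inner_neg_right, inner_smul_right, real_inner_self_eq_norm_sq] at hm
  nlinarith [mul_nonneg hτ (sq_nonneg ‖G x y‖)]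

/-- The implicit equation `y = x - τ ∇̄V(x, y)` is solvable as soon as its solutions for all
smaller step sizes satisfy an a priori bound. -/
theorem IsDiscreteGradient.exists_eq_sub_smul (hG : IsDiscreteGradient V G)
    {x : EuclideanSpace ℝ (Fin n)} {τ R : ℝ} (hτ : 0 ≤ τ)
    (hR : ∀ y, ∀ σ ∈ Set.Icc 0 τ, y = x - σ • G x y → V y ≤ V x → ‖y - x‖ ≤ R) :
    ∃ y, y = x - τ • G x y := by
  have hcont : Continuous fun u => -(τ • G x (x + u)) :=
    ((hG.continuous.comp (f := fun u => (x, x + u)) (by fun_prop)).const_smul τ).neg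
  obtain ⟨u, hu⟩ := exists_fixedPoint_of_bounded_homotopy hcont (R := R) fun u s hs hu => by
    have hy : x + u = x - (s * τ) • G x (x + u) := by
      conv_lhs => rw [hu]
      module
    have hσ : 0 ≤ s * τ := mul_nonneg hs.1 hτ
    simpa using hR (x + u) (s * τ) ⟨hσ, mul_le_of_le_one_left hτ hs.2⟩ hy
      (hG.le_of_eq_sub_smul hσ hy)
  refine ⟨x + u, ?_⟩
  conv_lhs => rw [hu]
  module

theorem IsDiscreteGradient.exists_eq_sub_smul_of_norm_le (hG : IsDiscreteGradient V G)
    {x : EuclideanSpace ℝ (Fin n)} {τ B : ℝ} (hτ : 0 ≤ τ)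
    (hB : ∀ y, V y ≤ V x → ‖G x y‖ ≤ B) : ∃ y, y = x - τ • G x y := by
  refine hG.exists_eq_sub_smul hτ (R := τ * B) fun y σ hσ hy hVy => ?_
  have hyx : y - x = -(σ • G x y) := by
    rw [sub_eq_iff_eq_add, neg_add_eq_sub]
    exact hy
  rw [hyx, norm_neg, norm_smul, Real.norm_of_nonneg hσ.1]
  have := hB y hVy
  exact mul_le_mul hσ.2 this (norm_nonneg _) hτ

theorem continuous_gradient (hV : ContDiff ℝ 1 V) : Continuous (gradient V) :=
  (InnerProductSpace.toDual ℝ _).symm.continuous.comp (hV.continuous_fderiv one_ne_zero)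

theorem gradient_eq_zero_of_forall_le {x : EuclideanSpace ℝ (Fin n)} (hx : ∀ y, V x ≤ V y) :
    gradient V x = 0 := by
  have hmin : IsLocalMin V x := Eventually.of_forall hx
  rw [gradient, hmin.fderiv_eq_zero, map_zero]

end DiscreteGradient

theorem mainTheorem1 {n : ℕ}
    (dg : (EuclideanSpace ℝ (Fin n) → ℝ) →
      EuclideanSpace ℝ (Fin n) → EuclideanSpace ℝ (Fin n) → EuclideanSpace ℝ (Fin n))
    (hdg : IsDiscreteGradientConstruction dg)
    (C : ℝ) (δ : ENNReal → ENNReal) (hass : BoundedAndLocal dg C δ)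
    (V : EuclideanSpace ℝ (Fin n) → ℝ) (hV : ContDiff ℝ 1 V)
    (τ : ℝ) (hτ : 0 < τ) (x : EuclideanSpace ℝ (Fin n))
    (h : (∃ L : ℝ, ∀ z, ‖gradient V z‖ ≤ L) ∨
      IsCoerciveFunction V ∨
      ((∃ M : ℝ, ∀ z ∈ convexHull ℝ {w | V w ≤ V x}, |V z| ≤ M) ∧
        (∃ L : ℝ, ∀ z ∈ convexHull ℝ {w | V w ≤ V x}, ‖gradient V z‖ ≤ L) ∧
        ∀ r, δ r = 0)) :
    ∃ y : EuclideanSpace ℝ (Fin n), y = x - τ • dg V x y := by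
  have hG := hdg V hV
  rcases h with ⟨L, hL⟩ | hco | ⟨-, ⟨L, hL⟩, hδ⟩
  · exact hG.exists_eq_sub_smul_of_norm_le hτ.le fun y _ =>
      hass.bounded V hV Set.univ convex_univ (by simp) L (fun z _ => hL z) x trivial y trivial
  · obtain ⟨R, hR⟩ := (hco (V x)).exists_norm_le
    refine hG.exists_eq_sub_smul hτ.le (R := R + ‖x‖) fun y _ _ _ hVy => ?_
    exact (norm_sub_le _ _).trans (by gcongr; exact hR y hVy)
  -- The locality assumption needs an interior point. Without one, the open set `{V < V x}` is
  -- empty, so `x` is a global minimum and `y = x` works.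
  · by_cases hint : (interior (convexHull ℝ {w | V w ≤ V x})).Nonempty
    · refine hG.exists_eq_sub_smul_of_norm_le hτ.le fun y hy =>
        hass.bounded V hV _ (convex_convexHull ℝ _) hint L (fun z hz => ?_)
          x (subset_convexHull ℝ _ (le_refl (V x))) y (subset_convexHull ℝ _ hy)
      -- With `δ = 0` the thickening is the closure, to which the bound extends by continuity of the
      -- gradient.
      have hz' : z ∈ closure (convexHull ℝ {w | V w ≤ V x}) := by
        rw [Metric.mem_closure_iff_infEDist_zero]
        simpa [closedThickening, hδ] using hz
      exact closure_minimal (t := {z | ‖gradient V z‖ ≤ L}) hL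
        (isClosed_le (continuous_gradient hV).norm continuous_const) hz'
    · have hmin : ∀ y, V x ≤ V y := by
        intro y
        by_contra! hy
        refine hint ⟨y, mem_interior.2 ⟨{w | V w < V x}, ?_, ?_, hy⟩⟩
        · exact fun w hw => subset_convexHull ℝ _ (show V w ≤ V x from le_of_lt hw)
        · exact isOpen_lt hV.continuous continuous_const
      refine ⟨x, ?_⟩
      rw [hG.apply_self, gradient_eq_zero_of_forall_le hmin, smul_zero, sub_zero]
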